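/- Let $F$ be a real or complex Banach space with a finite-dimensional decomposition $(F_i)_{i\in\mathbb N}$, i.e. the $F_i$ are finite-dimensional subspaces of $F$ and every $x\in F$ can be written uniquely as a norm-convergent series $x=\sum_i f_i$ with $f_i\in F_i$. Let $E\subseteq F$ be a closed subspace with unit sphere $S_E$, and equip $S_E^\infty=S_E^{\mathbb N}$ with the product topology. "Interval" means a non-empty finite interval of $\mathbb N$; $I<J$ means $\max I<\min J$, and similarly for comparisons of intervals with numbers; for $x=\sum_i f_i$ as above put $P_I(x)=\sum_{i\in I}f_i$. Write $\Delta>0$ to express that $\Delta=(\delta_i)_{i\ge 0}$ is a decreasing (not necessarily strictly) sequence of strictly positive reals converging to $0$. For $\Delta>0$, $\mathcal B\subseteq S_E^\infty$, $(x_i)\in S_E^\infty$ and a strictly increasing sequence $(m_i)_{i\geq 0}$ of natural numbers: - ${\rm Int}_\Delta(\mathcal B)$ is the set of $(y_i)\in S_E^\infty$ such that every $(z_i)\in S_E^\infty$ with $\|z_i-y_i\|<\delta_i$ for all $i$ belongs to $\mathcal B$. - $\mathcal R_\Delta(m_i,x_i)$ means that there are intervals $I_0<I_1<\cdots$ with $\|P_{I_i}(x_i)-x_i\|<\delta_i$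 for all $i$ (so $(x_i)$ is a $\Delta$-block sequence) such that $m_0<I_0$ and for every $i$ there is $j$ with $I_i<m_j<m_{j+1}<I_{i+1}$. - In the $\Delta$-game, players I and II alternate, I beginning: in round $i$ player I chooses $n_i\in\mathbb N$, and then II chooses $x_i\in S_E$ and an interval $I_i$ with $\|x_i-P_{I_i}(x_i)\|<\delta_i$, $n_i<I_i$ and, if $i\ge1$, $I_{i-1}<I_i$. Player I has a strategy to play in $\mathcal A\subseteq S_E^\infty$ if there is a function giving each $n_i$ from $(x_0,I_0),\dots,(x_{i-1},I_{i-1})$ such that in every infinite run in which I follows it and II obeys these rules, the outcome $(x_i)$ lies in $\mathcal A$. - A $\Delta$-block tree is a non-empty set $T$ of finite sequences in $S_E$, closed under initial segments, such that for every $(x_0,\dots,x_{n-1})\in T$ (including the empty sequence, $n=0$) the set $\{y\in S_E : (x_0,\dots,x_{n-1},y)\in T\}$ can be written as $\{y_i\}_{i=0}^\infty$ for which there are intervals $I_i$ with $\|y_i-P_{I_i}(y_i)\|<\delta_n$ for all $i$ and $\min I_i\to\infty$. $[T]$ is the set of $(x_i)\in S_E^\infty$ all of whose finite initial segments are in $T$.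 Let $\mathcal B\subseteq S_E^\infty$ be coanalytic (i.e. $S_E^\infty\setminus\mathcal B$ is analytic). Then the following are equivalent: (d) there are $\Delta>0$ and a strictly increasing sequence $(m_i)$ of natural numbers such that every $(x_i)\in S_E^\infty$ with $\mathcal R_\Delta(m_i,x_i)$ lies in ${\rm Int}_\Delta(\mathcal B)$; (e) there is $\Delta>0$ such that player I has a strategy in the $\Delta$-game to play in ${\rm Int}_\Delta(\mathcal B)$; (f) there is $\Delta>0$ such that every $\Delta$-block tree $T$ satisfies $[T]\cap{\rm Int}_\Delta(\mathcal B)\neq\emptyset$. -/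

import Mathlib

open Filter Topology

namespace ApproxGame

section

variable {𝕜 X : Type*} [RCLike 𝕜] [NormedAddCommGroup X] [NormedSpace 𝕜 X]

/-- A finite-dimensional decomposition (F.D.D.) of `X`: a sequence of finite-dimensional subspaces
`F i` such that every `x` is in a unique way the sum of a norm-convergent series `∑ f i` with
`f i ∈ F i`. -/
structure FDD (𝕜 X : Type*) [RCLike 𝕜] [NormedAddCommGroup X] [NormedSpace 𝕜 X] where
  space : ℕ → Submodule 𝕜 X
  finiteDimensional : ∀ i, FiniteDimensional 𝕜 (space i)
  existsUnique_expansion : ∀ x : X, ∃! f : ∀ i, space i,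
    Tendsto (fun n => ∑ i ∈ Finset.range n, (f i : X)) atTop (𝓝 x)

/-- The `i`-th term of the expansion of `x` along the decomposition. -/
noncomputable def FDD.coord (F : FDD 𝕜 X) (x : X) (i : ℕ) : X :=
  ((F.existsUnique_expansion x).choose i : X)

/-- The projection `P_I` of `X` onto `⊕_{i ∈ I} F i`, for a non-empty finite interval
`I = {I.fst, …, I.snd}` of natural numbers. -/
noncomputable def FDD.proj (F : FDD 𝕜 X) (I : NonemptyInterval ℕ) (x : X) : X :=
  ∑ i ∈ Finset.Icc I.fst I.snd, F.coord x i

/-- The unit sphere `S_E` of a subspace `E`. -/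
abbrev Sph (E : Submodule 𝕜 X) : Type _ := Metric.sphere (0 : E) 1

/-- The underlying vector in `X` of a point of `S_E`. -/
abbrev Sph.vec {E : Submodule 𝕜 X} (x : Sph E) : X := ((x : E) : X)

/-- `Δ > 0`: a decreasing sequence of strictly positive reals converging to `0`. -/
def IsGauge (δ : ℕ → ℝ) : Prop :=
  Antitone δ ∧ (∀ i, 0 < δ i) ∧ Tendsto δ atTop (𝓝 0)

/-- `I < J` for intervals: every element of `I` is below every element of `J`. -/
def Before (I J : NonemptyInterval ℕ) : Prop := I.snd < J.fst

/-- `(x i)` is a `Δ`-block, as witnessed by the intervals `I 0 < I 1 < I 2 < …`. -/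
def IsBlockWith (F : FDD 𝕜 X) {E : Submodule 𝕜 X} (δ : ℕ → ℝ) (x : ℕ → Sph E)
    (I : ℕ → NonemptyInterval ℕ) : Prop :=
  (∀ i, Before (I i) (I (i + 1))) ∧ ∀ i, ‖F.proj (I i) (x i).vec - (x i).vec‖ < δ i

/-- `R(m, I)`: `m 0 < I 0`, and for every `i` there is `j` with
`I i < m j < m (j + 1) < I (i + 1)`. -/
def SeparatesIntervals (m : ℕ → ℕ) (I : ℕ → NonemptyInterval ℕ) : Prop :=
  m 0 < (I 0).fst ∧
    ∀ i, ∃ j, (I i).snd < m j ∧ m j < m (j + 1) ∧ m (j + 1) < (I (i + 1)).fst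

/-- `R_Δ(m, x)`: `(x i)` is a `Δ`-block with a witness `(I i)` satisfying `R(m, I)`. -/
def Separates (F : FDD 𝕜 X) {E : Submodule 𝕜 X} (δ : ℕ → ℝ) (m : ℕ → ℕ)
    (x : ℕ → Sph E) : Prop :=
  ∃ I : ℕ → NonemptyInterval ℕ, IsBlockWith F δ x I ∧ SeparatesIntervals m I

/-- `Int_Δ(B)`. -/
def deltaInt {E : Submodule 𝕜 X} (δ : ℕ → ℝ) (B : Set (ℕ → Sph E)) : Set (ℕ → Sph E) :=
  {y | ∀ x : ℕ → Sph E, (∀ i, ‖(x i).vec - (y i).vec‖ < δ i) → x ∈ B}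

/-- The initial segment `(z 0, …, z (n - 1))` of an infinite sequence. -/
def initSeg {α : Type*} (z : ℕ → α) (n : ℕ) : List α := List.ofFn fun i : Fin n => z i

/-- A `Δ`-block tree: a non-empty set of finite sequences in `S_E`, closed under initial segments,
such that for every `s ∈ T` of length `n` the set of `y` with `s ⌢ y ∈ T` can be written as
`{y 0, y 1, …}` with intervals `I i` for which `‖y i - P_{I i} (y i)‖ < δ n` and
`min (I i) → ∞`. -/
def IsBlockTree (F : FDD 𝕜 X) {E : Submodule 𝕜 X} (δ : ℕ → ℝ) (T : Set (List (Sph E))) : Prop :=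
  T.Nonempty ∧ (∀ s t : List (Sph E), s <+: t → t ∈ T → s ∈ T) ∧
    ∀ s ∈ T, ∃ (y : ℕ → Sph E) (I : ℕ → NonemptyInterval ℕ),
      {z : Sph E | s ++ [z] ∈ T} = Set.range y ∧
      (∀ i, ‖(y i).vec - F.proj (I i) (y i).vec‖ < δ s.length) ∧
      Tendsto (fun i => (I i).fst) atTop atTop

/-- The set `[T]` of infinite branches of `T`. -/
def branches {α : Type*} (T : Set (List α)) : Set (ℕ → α) := {x | ∀ n, initSeg x n ∈ T}

/-- A strategy for player I in the `Δ`-game: it tells which natural number `n_k` to play after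
player II has played `(x_0, I_0), …, (x_{k-1}, I_{k-1})`. -/
abbrev StrategyI (E : Submodule 𝕜 X) : Type _ := List (Sph E × NonemptyInterval ℕ) → ℕ

/-- The infinite run in which II plays `(x i, I i)` and I follows `σ`, so that I plays
`n_i = σ ((x 0, I 0), …, (x (i - 1), I (i - 1)))`, obeys the rules of the `Δ`-game:
`‖x i - P_{I i} (x i)‖ < δ i` and `n_i < I i < I (i + 1)` for every `i`. -/
def IsRun (F : FDD 𝕜 X) {E : Submodule 𝕜 X} (δ : ℕ → ℝ) (σ : StrategyI E) (x : ℕ → Sph E)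
    (I : ℕ → NonemptyInterval ℕ) : Prop :=
  ∀ i, ‖(x i).vec - F.proj (I i) (x i).vec‖ < δ i ∧
    σ (initSeg (fun k => (x k, I k)) i) < (I i).fst ∧ Before (I i) (I (i + 1))

/-- Player I has a strategy in the `Δ`-game to play in `A`: the outcome `(x i)` of every run of the
game in which I follows the strategy lies in `A`. -/
def HasStrategyI (F : FDD 𝕜 X) {E : Submodule 𝕜 X} (δ : ℕ → ℝ) (A : Set (ℕ → Sph E)) : Prop :=
  ∃ σ : StrategyI E, ∀ (x : ℕ → Sph E) (I : ℕ → NonemptyInterval ℕ), IsRun F δ σ x I → x ∈ A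

end

end ApproxGame

namespace ApproxGame

/-! ### Initial segments and dependent choice -/

section Lists

variable {α : Type*}

@[simp] theorem length_initSeg (z : ℕ → α) (n : ℕ) : (initSeg z n).length = n := by
  simp [initSeg]

@[simp] theorem initSeg_zero (z : ℕ → α) : initSeg z 0 = [] := by
  simp [initSeg]

theorem initSeg_succ (z : ℕ → α) (n : ℕ) : initSeg z (n + 1) = initSeg z n ++ [z n] := by
  rw [initSeg, List.ofFn_succ_last]
  simp [initSeg]

@[simp] theorem getElem_initSeg (z : ℕ → α) (n i : ℕ) (h : i < (initSeg z n).length) :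
    (initSeg z n)[i] = z i := by
  simp [initSeg]

theorem take_initSeg (z : ℕ → α) {m n : ℕ} (h : m ≤ n) :
    (initSeg z n).take m = initSeg z m := by
  apply List.ext_getElem <;> simp [h]

theorem map_initSeg {β : Type*} (g : α → β) (z : ℕ → α) (n : ℕ) :
    (initSeg z n).map g = initSeg (fun i => g (z i)) n := by
  apply List.ext_getElem <;> simp

theorem mem_initSeg {z : ℕ → α} {n : ℕ} {a : α} : a ∈ initSeg z n ↔ ∃ i < n, z i = a := by
  simp [initSeg, List.mem_ofFn, Fin.exists_iff]

theorem exists_seq_of_extend (P : List α → Prop) (R : List α → α → Prop) (h0 : P [])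
    (h : ∀ l, P l → ∃ a, R l a ∧ P (l ++ [a])) :
    ∃ z : ℕ → α, ∀ n, P (initSeg z n) ∧ R (initSeg z n) (z n) := by
  choose f hR hP using h
  let st : ℕ → {l // P l} := fun n =>
    Nat.rec ⟨[], h0⟩ (fun _ s => ⟨s.1 ++ [f s.1 s.2], hP s.1 s.2⟩) n
  let z : ℕ → α := fun n => f (st n).1 (st n).2
  have hz : ∀ n, initSeg z n = (st n).1 := by
    intro n
    induction n with
    | zero => simp [st]
    | succ n ih => rw [initSeg_succ, ih]
  refine ⟨z, fun n => ?_⟩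
  rw [hz]
  exact ⟨(st n).2, hR _ _⟩

end Lists

/-! ### The unfolded game: refutation or escape -/

section Dichotomy

variable {α : Type*}

/-- Player I, who can force the next point of a list `l` to lie in `D l.length n` for any `n`,
is able to refute all extensions of the witness `t` from the position `h` on. -/
inductive Refuted (D : ℕ → ℕ → Set α) (G : List α → List ℕ → Prop) : List ℕ → List α → Prop
  | mk (t : List ℕ) (h : List α) (S : Set (List α)) (n : List α → ℕ) (mem : h ∈ S)
      (stay : ∀ l ∈ S, ∀ x ∈ D l.length (n l), l ++ [x] ∈ S)
      (refute : ∀ l ∈ S, ∀ x ∈ D l.length (n l), ∀ d ≤ l.length, G (l ++ [x]) (t ++ [d]) →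
        Refuted D G (t ++ [d]) (l ++ [x])) : Refuted D G t h

/-- A well-founded strategy for player II to extend the witness `t` by one further digit, leading
to a position which is not refuted. -/
inductive Escape (D : ℕ → ℕ → Set α) (G : List α → List ℕ → Prop) (t : List ℕ) :
    List α → Type _
  | node (h : List α) (mv : ℕ → α) (mem : ∀ n, mv n ∈ D h.length n) (digit : ℕ → Option ℕ)
      (done : ∀ n d, digit n = some d →
        G (h ++ [mv n]) (t ++ [d]) ∧ ¬ Refuted D G (t ++ [d]) (h ++ [mv n]))
      (next : ∀ n, digit n = none → Escape D G t (h ++ [mv n])) : Escape D G t h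

variable {D : ℕ → ℕ → Set α} {G : List α → List ℕ → Prop}

/-- Since `D k` is decreasing, playing the maximum of finitely many numbers obeys all the strategies
they come from. So I follows one strategy for each digit and each earlier position at which it could
have been guessed; digits beyond the current length join later. -/
theorem Refuted.exists_strategy (hD : ∀ k, Antitone (D k)) {t : List ℕ} {h : List α}
    (hr : Refuted D G t h) :
    ∃ σ : List α → ℕ, ∀ x : ℕ → α, initSeg x h.length = h →
      (∀ i, h.length ≤ i → x i ∈ D i (σ (initSeg x i))) → ∀ β : ℕ → ℕ, initSeg β t.length = t →
        ¬ ∀ k l, l ≤ k → G (initSeg x k) (initSeg β l) := by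
  induction hr with
  | mk t h S n mem stay refute ih =>
    -- The strategy is picked for every pair, with a dummy where none exists, because which pairs
    -- are refuted depends on the run.
    have key : ∀ (d : ℕ) (l : List α), ∃ τ : List α → ℕ,
        (∃ σ : List α → ℕ, ∀ x : ℕ → α, initSeg x l.length = l →
          (∀ i, l.length ≤ i → x i ∈ D i (σ (initSeg x i))) → ∀ β : ℕ → ℕ,
          initSeg β (t ++ [d]).length = t ++ [d] →
          ¬ ∀ k l, l ≤ k → G (initSeg x k) (initSeg β l)) →
        ∀ x : ℕ → α, initSeg x l.length = l →
          (∀ i, l.length ≤ i → x i ∈ D i (τ (initSeg x i))) → ∀ β : ℕ → ℕ,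
          initSeg β (t ++ [d]).length = t ++ [d] →
          ¬ ∀ k l, l ≤ k → G (initSeg x k) (initSeg β l) := by
      intro d l
      by_cases hs : ∃ σ : List α → ℕ, ∀ x : ℕ → α, initSeg x l.length = l →
          (∀ i, l.length ≤ i → x i ∈ D i (σ (initSeg x i))) → ∀ β : ℕ → ℕ,
          initSeg β (t ++ [d]).length = t ++ [d] →
          ¬ ∀ k l, l ≤ k → G (initSeg x k) (initSeg β l)
      · obtain ⟨σ, hσ⟩ := hs
        exact ⟨σ, fun _ => hσ⟩
      · exact ⟨fun _ => 0, fun hs' => absurd hs' hs⟩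
    choose τ hτ using key
    refine ⟨fun l => max (n l) ((Finset.range (l.length + 1) ×ˢ Finset.range (l.length + 1)).sup
      fun p => τ p.1 (l.take p.2) l), fun x hx hrun β hβ hG => ?_⟩
    have hn : ∀ i, h.length ≤ i → x i ∈ D (initSeg x i).length (n (initSeg x i)) := by
      intro i hi
      rw [length_initSeg]
      exact hD i (le_max_left _ _) (hrun i hi)
    have hS : ∀ k, h.length ≤ k → initSeg x k ∈ S := by
      intro k hk
      induction k, hk using Nat.le_induction with
      | base => rwa [hx]
      | succ k hk hS =>
        rw [initSeg_succ]
        exact stay _ hS _ (hn k hk)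
    set d := β t.length with hd
    -- The guess of `d` is postponed to a round late enough for `d` to be covered and for the
    -- position to be as long as the witness.
    obtain ⟨k, hk, hkd, hkt⟩ : ∃ k, h.length ≤ k ∧ d ≤ k ∧ t.length ≤ k :=
      ⟨max h.length (max d t.length), by simp, by simp, by simp⟩
    have hβ' : initSeg β (t ++ [d]).length = t ++ [d] := by
      rw [List.length_append, List.length_singleton, initSeg_succ, hβ]
    have hGk : G (initSeg x k ++ [x k]) (t ++ [d]) := by
      rw [← initSeg_succ, ← hβ']
      exact hG _ _ (by simpa using hkt)
    have hdk : d ≤ (initSeg x k).length := by simpa using hkd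
    refine hτ d (initSeg x k ++ [x k])
      (ih _ (hS k hk) _ (hn k hk) d hdk hGk) x ?_ ?_ β hβ' hG
    · rw [← initSeg_succ, length_initSeg]
    · rw [← initSeg_succ, length_initSeg]
      intro i hi
      refine hD i ?_ (hrun i (by omega))
      refine le_trans ?_ (le_max_right _ _)
      have := Finset.le_sup (f := fun p : ℕ × ℕ => τ p.1 ((initSeg x i).take p.2) (initSeg x i))
        (s := Finset.range ((initSeg x i).length + 1) ×ˢ Finset.range ((initSeg x i).length + 1))
        (b := (d, k + 1)) (by simp; omega)
      simpa only [take_initSeg x hi] using this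

/-- The positions without an escape form the set `S` of a refutation: if at one of them every number
of I had a reply with an escape, or with a coherent unrefuted digit, these replies would assemble
into a node. -/
theorem nonempty_escape {t : List ℕ} {h : List α} (hr : ¬ Refuted D G t h) :
    Nonempty (Escape D G t h) := by
  by_contra hE
  have key : ∀ l, ∃ n, IsEmpty (Escape D G t l) → ∀ x ∈ D l.length n,
      IsEmpty (Escape D G t (l ++ [x])) ∧
        ∀ d, G (l ++ [x]) (t ++ [d]) → Refuted D G (t ++ [d]) (l ++ [x]) := by
    intro l
    by_contra! hl
    have hemp := (hl 0).1
    choose mv hmv hmv' using fun n => (hl n).2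
    have hd : ∀ n, ∃ o : Option ℕ, (∀ d, o = some d →
        G (l ++ [mv n]) (t ++ [d]) ∧ ¬ Refuted D G (t ++ [d]) (l ++ [mv n])) ∧
        (o = none → Nonempty (Escape D G t (l ++ [mv n]))) := by
      intro n
      by_cases hne : Nonempty (Escape D G t (l ++ [mv n]))
      · exact ⟨none, by simp, fun _ => hne⟩
      · obtain ⟨d, hd⟩ := hmv' n (not_nonempty_iff.1 hne)
        exact ⟨some d, by rintro _ ⟨⟩; exact hd, by simp⟩
    choose digit hdone hnext using hd
    exact hemp.elim (.node l mv hmv digit hdone fun n hn => (hnext n hn).some)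
  choose n hn using key
  exact hr (.mk t h {l | IsEmpty (Escape D G t l)} n (not_nonempty_iff.1 hE)
    (fun l hl x hx => (hn l hl x hx).1) fun l hl x hx d _ => (hn l hl x hx).2 d)

/-- A position of player II in the game with witnesses. -/
structure Pos (D : ℕ → ℕ → Set α) (G : List α → List ℕ → Prop) where
  witness : List ℕ
  played : List α
  escape : Escape D G witness played

/-- The point which II plays in reply to `n`. -/
def Pos.move : Pos D G → ℕ → α
  | ⟨_, _, .node _ mv _ _ _ _⟩, n => mv n

/-- The position after II's reply to `n`. -/
noncomputable def Pos.step : Pos D G → ℕ → Pos D G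
  | ⟨t, h, .node _ mv _ digit done next⟩, n =>
    match hn : digit n with
    | some d => ⟨t ++ [d], h ++ [mv n], (nonempty_escape (done n d hn).2).some⟩
    | none => ⟨t, h ++ [mv n], next n hn⟩

theorem Pos.move_mem (p : Pos D G) (n : ℕ) : p.move n ∈ D p.played.length n := by
  obtain ⟨t, h, ⟨_, mv, mem, digit, done, next⟩⟩ := p
  exact mem n

theorem Pos.played_step (p : Pos D G) (n : ℕ) : (p.step n).played = p.played ++ [p.move n] := by
  obtain ⟨t, h, ⟨_, mv, mem, digit, done, next⟩⟩ := p
  unfold Pos.step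
  dsimp only
  split <;> rfl

theorem Pos.witness_prefix_step (p : Pos D G) (n : ℕ) : p.witness <+: (p.step n).witness := by
  obtain ⟨t, h, ⟨_, mv, mem, digit, done, next⟩⟩ := p
  unfold Pos.step
  dsimp only
  split
  · exact List.prefix_append _ _
  · exact List.prefix_refl _

theorem Pos.step_good (hG : ∀ h t x, G h t → G (h ++ [x]) t) (p : Pos D G) (n : ℕ)
    (hp : G p.played p.witness) : G (p.step n).played (p.step n).witness := by
  obtain ⟨t, h, ⟨_, mv, mem, digit, done, next⟩⟩ := p
  unfold Pos.step
  dsimp only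
  split
  · next d hd => exact (done n d hd).1
  · exact hG _ _ _ hp

/-- Escapes are well-founded, so II cannot postpone the next digit forever. -/
theorem Escape.exists_witness_lt {t : List ℕ} {h : List α} (e : Escape D G t h) :
    ∀ (n : ℕ → ℕ) (q : ℕ → Pos D G), q 0 = ⟨t, h, e⟩ → (∀ k, q (k + 1) = (q k).step (n k)) →
      ∃ k, t.length < (q k).witness.length := by
  induction e with
  | node h mv mem digit done next ih =>
    intro n q h0 hq
    have h1 := hq 0
    rw [h0] at h1
    unfold Pos.step at h1
    dsimp only at h1
    split at h1
    · exact ⟨1, by simp [h1]⟩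
    · next hn =>
      obtain ⟨k, hk⟩ := ih (n 0) hn (fun k => n (k + 1)) (fun k => q (k + 1)) h1 fun k => hq _
      exact ⟨k + 1, hk⟩

theorem Pos.exists_le_witness (n : ℕ → ℕ) (q : ℕ → Pos D G)
    (hq : ∀ k, q (k + 1) = (q k).step (n k)) (m : ℕ) : ∃ k, m ≤ (q k).witness.length := by
  induction m with
  | zero => exact ⟨0, Nat.zero_le _⟩
  | succ m ih =>
    obtain ⟨k, hk⟩ := ih
    obtain ⟨k', hk'⟩ := (q k).escape.exists_witness_lt (fun i => n (k + i)) (fun i => q (k + i)) rfl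
      fun i => hq (k + i)
    exact ⟨k + k', by omega⟩

/-- The position after the points of a list have been played by II. Player I's numbers are
reconstructed as the least ones to which II replies in this way. -/
noncomputable def Pos.run (p : Pos D G) (s : List α) : Pos D G :=
  s.foldl (fun q y => q.step (sInf {n | q.move n = y})) p

theorem Pos.run_append (p : Pos D G) (s : List α) (y : α) :
    p.run (s ++ [y]) = (p.run s).step (sInf {n | (p.run s).move n = y}) := by
  simp [Pos.run]

theorem Pos.length_played_run (p : Pos D G) (s : List α) :
    (p.run s).played.length = p.played.length + s.length := by
  induction s using List.reverseRecOn with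
  | nil => simp [Pos.run]
  | append_singleton s y ih =>
    rw [Pos.run_append, Pos.played_step]
    simp [ih, add_assoc]

/-- The tree of all sequences of points that II plays from the position `p`. -/
def Pos.tree (p : Pos D G) : Set (List α) :=
  {l | ∀ s y, s ++ [y] <+: l → ∃ n, (p.run s).move n = y}

theorem Pos.played_run (p : Pos D G) {s : List α} (hs : s ∈ p.tree) :
    (p.run s).played = p.played ++ s := by
  induction s using List.reverseRecOn with
  | nil => simp [Pos.run]
  | append_singleton s y ih =>
    have hy : (p.run s).move (sInf {n | (p.run s).move n = y}) = y :=
      Nat.sInf_mem (s := {n | (p.run s).move n = y}) (hs s y (List.prefix_refl _))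
    rw [Pos.run_append, Pos.played_step, hy,
      ih fun s' y' h => hs s' y' (h.trans (List.prefix_append _ _)), List.append_assoc]

theorem Pos.setOf_append_mem_tree (p : Pos D G) {s : List α} (hs : s ∈ p.tree) :
    {z | s ++ [z] ∈ p.tree} = Set.range (p.run s).move := by
  ext z
  constructor
  · intro hz
    exact hz s z (List.prefix_refl _)
  · rintro ⟨n, rfl⟩ s' y h
    rcases List.prefix_concat_iff.1 h with h | h
    · obtain ⟨rfl, h⟩ := List.append_inj' h rfl
      exact ⟨n, by simpa using h.symm⟩
    · exact hs s' y h

theorem exists_eq_initSeg {t : ℕ → List ℕ} (ht : ∀ k, t k <+: t (k + 1))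
    (hlen : ∀ m, ∃ k, m ≤ (t k).length) : ∃ β : ℕ → ℕ, ∀ k, t k = initSeg β (t k).length := by
  have hmono : ∀ k l, k ≤ l → t k <+: t l := by
    intro k l hkl
    induction l, hkl using Nat.le_induction with
    | base => exact List.prefix_refl _
    | succ l _ ih => exact ih.trans (ht l)
  choose K hK using fun m => hlen (m + 1)
  refine ⟨fun i => (t (K i))[i]'(hK i), fun k => List.ext_getElem (by simp) fun i h1 h2 => ?_⟩
  rw [getElem_initSeg]
  rcases le_total k (K i) with h | h
  · exact (hmono _ _ h).getElem h1
  · exact ((hmono _ _ h).getElem (hK i)).symm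

theorem Pos.exists_witness_of_mem_branches (hG : ∀ h t x, G h t → G (h ++ [x]) t) (p : Pos D G)
    (hp : G p.played p.witness) (h0 : p.played = []) {x : ℕ → α} (hx : x ∈ branches p.tree) :
    ∃ β : ℕ → ℕ, ∀ m, ∃ k l, m ≤ l ∧ G (initSeg x k) (initSeg β l) := by
  set q : ℕ → Pos D G := fun k => p.run (initSeg x k) with hqdef
  have hq : ∀ k, q (k + 1) = (q k).step (sInf {n | (q k).move n = x k}) := by
    intro k
    simp only [hqdef, initSeg_succ, Pos.run_append]
  have hgood : ∀ k, G (q k).played (q k).witness := by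
    intro k
    induction k with
    | zero => simpa [hqdef, Pos.run] using hp
    | succ k ih =>
      rw [hq]
      exact Pos.step_good hG _ _ ih
  have hlen := Pos.exists_le_witness _ q hq
  obtain ⟨β, hβ⟩ := exists_eq_initSeg (t := fun k => (q k).witness)
    (fun k => by rw [hq]; exact Pos.witness_prefix_step _ _) hlen
  refine ⟨β, fun m => ?_⟩
  obtain ⟨k, hk⟩ := hlen m
  refine ⟨k, _, hk, ?_⟩
  have := hgood k
  rwa [hβ k, p.played_run (hx k), h0, List.nil_append] at this

/-- Dichotomy for the asymptotic game in which I restricts the `k`-th point of II to a set from a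
decreasing sequence `D k`, and II tries to play a sequence for which a witness exists. -/
theorem strategy_or_tree (hD : ∀ k, Antitone (D k)) (hG : ∀ h t x, G h t → G (h ++ [x]) t)
    (h0 : G [] []) :
    (∃ σ : List α → ℕ, ∀ x : ℕ → α, (∀ i, x i ∈ D i (σ (initSeg x i))) →
      ∀ β : ℕ → ℕ, ¬ ∀ k l, l ≤ k → G (initSeg x k) (initSeg β l)) ∨
    ∃ T : Set (List α), T.Nonempty ∧ (∀ s t, s <+: t → t ∈ T → s ∈ T) ∧
      (∀ s ∈ T, ∃ y : ℕ → α, {z | s ++ [z] ∈ T} = Set.range y ∧ ∀ n, y n ∈ D s.length n) ∧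
      ∀ x ∈ branches T, ∃ β : ℕ → ℕ, ∀ m, ∃ k l, m ≤ l ∧ G (initSeg x k) (initSeg β l) := by
  by_cases hr : Refuted D G [] []
  · left
    obtain ⟨σ, hσ⟩ := hr.exists_strategy hD
    exact ⟨σ, fun x hx β => hσ x (by simp) (fun i _ => hx i) β (by simp)⟩
  · right
    let p : Pos D G := ⟨[], [], (nonempty_escape hr).some⟩
    refine ⟨p.tree, ⟨[], ?_⟩, fun s t hst ht s' y h => ht s' y (h.trans hst),
      fun s hs => ⟨_, p.setOf_append_mem_tree hs, fun n => ?_⟩,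
      fun x hx => p.exists_witness_of_mem_branches hG h0 rfl hx⟩
    · intro s y h
      simp at h
    · have := (p.run s).move_mem n
      rwa [p.length_played_run, show p.played.length = 0 from rfl, zero_add] at this

end Dichotomy

/-! ### Approximating outcomes by points of an analytic set -/

section Coherent

variable {α : Type*} [PseudoMetricSpace α]

/-- Some sequence `β` starting with `t` has an image which is `ε`-close to `h` in the first
`t.length` coordinates. -/
def Coherent (γ : (ℕ → ℕ) → ℕ → α) (ε : ℕ → ℝ) (h : List α) (t : List ℕ) : Prop :=
  ∃ β : ℕ → ℕ, initSeg β t.length = t ∧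
    ∀ j < t.length, ∃ hj : j < h.length, dist h[j] (γ β j) ≤ ε j

variable {γ : (ℕ → ℕ) → ℕ → α} {ε : ℕ → ℝ}

theorem Coherent.append {h : List α} {t : List ℕ} (x : α) (hc : Coherent γ ε h t) :
    Coherent γ ε (h ++ [x]) t := by
  obtain ⟨β, hβ, hd⟩ := hc
  refine ⟨β, hβ, fun j hj => ?_⟩
  obtain ⟨hj', hd'⟩ := hd j hj
  refine ⟨by simp; omega, ?_⟩
  rwa [List.getElem_append_left hj']

theorem coherent_initSeg {x : ℕ → α} {β : ℕ → ℕ} (h : ∀ j, dist (x j) (γ β j) ≤ ε j) {k l : ℕ}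
    (hlk : l ≤ k) : Coherent γ ε (initSeg x k) (initSeg β l) := by
  refine ⟨β, by simp, fun j hj => ?_⟩
  rw [length_initSeg] at hj
  exact ⟨by simp; omega, by simpa using h j⟩

/-- Coherence supplies sequences agreeing with `β` on ever longer segments; continuity of `γ` and
the non-strict bound pass closeness to the limit. -/
theorem dist_le_of_coherent (hγ : Continuous γ) {x : ℕ → α} {β : ℕ → ℕ}
    (h : ∀ m, ∃ k l, m ≤ l ∧ Coherent γ ε (initSeg x k) (initSeg β l)) (j : ℕ) :
    dist (x j) (γ β j) ≤ ε j := by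
  have h' : ∀ m, ∃ b : ℕ → ℕ, (∀ i < m, b i = β i) ∧ ∀ i < m, dist (x i) (γ b i) ≤ ε i := by
    intro m
    obtain ⟨k, l, hml, b, hb, hd⟩ := h m
    rw [length_initSeg] at hb hd
    refine ⟨b, fun i hi => ?_, fun i hi => ?_⟩
    · have hi' : i < (initSeg b l).length := by simp; omega
      rw [← getElem_initSeg b l i hi', ← getElem_initSeg β l i (by simp; omega)]
      simp only [hb]
    · obtain ⟨hj, hd⟩ := hd i (by omega)
      simpa using hd
  choose b hb hd using h'
  have hlim : Tendsto b atTop (𝓝 β) := by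
    rw [tendsto_pi_nhds]
    intro i
    apply tendsto_const_nhds.congr'
    filter_upwards [eventually_gt_atTop i] with m hm
    exact (hb m i hm).symm
  have hlim' : Tendsto (fun m => dist (x j) (γ (b m) j)) atTop (𝓝 (dist (x j) (γ β j))) :=
    tendsto_const_nhds.dist (((continuous_apply j).comp hγ).continuousAt.tendsto.comp hlim)
  refine le_of_tendsto hlim' ?_
  filter_upwards [eventually_gt_atTop j] with m hm
  exact hd m j hm

end Coherent

/-! ### Strategies and block trees -/

section Game

variable {𝕜 X : Type*} [RCLike 𝕜] [NormedAddCommGroup X] [NormedSpace 𝕜 X]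
  {F : FDD 𝕜 X} {E : Submodule 𝕜 X} {δ : ℕ → ℝ}

theorem IsGauge.div (hδ : IsGauge δ) {c : ℝ} (hc : 0 < c) : IsGauge fun i => δ i / c := by
  refine ⟨fun i j hij => ?_, fun i => div_pos (hδ.2.1 i) hc, by simpa using hδ.2.2.div_const c⟩
  have := hδ.1 hij
  dsimp only
  gcongr

theorem dist_eq_norm_vec (x y : Sph E) : dist x y = ‖x.vec - y.vec‖ := by
  rw [Subtype.dist_eq, Subtype.dist_eq, dist_eq_norm]

/-- The points of `S_E` which II may play with tolerance `r` in reply to the number `n`. -/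
def farSet (F : FDD 𝕜 X) (E : Submodule 𝕜 X) (r : ℝ) (n : ℕ) : Set (Sph E) :=
  {x | ∃ I : NonemptyInterval ℕ, n < I.fst ∧ ‖x.vec - F.proj I x.vec‖ < r}

theorem hasStrategyI_of_separates {m : ℕ → ℕ} (hm : StrictMono m) {A : Set (ℕ → Sph E)}
    (h : ∀ x, Separates F δ m x → x ∈ A) : HasStrategyI F δ A := by
  -- After an interval ending at `b`, both `m (b + 1)`, which exceeds `b`, and `m (b + 2)` fit into
  -- the gap. The default `m 0` is the opening move.
  refine ⟨fun l => (l.getLast?.map fun p => m (p.2.snd + 2)).getD (m 0), fun x I hrun => ?_⟩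
  refine h x ⟨I, ⟨fun i => (hrun i).2.2, fun i => ?_⟩, ?_, fun i => ⟨(I i).snd + 1, ?_, ?_, ?_⟩⟩
  · rw [norm_sub_rev]
    exact (hrun i).1
  · simpa using (hrun 0).2.1
  · exact Nat.lt_of_lt_of_le (Nat.lt_succ_self _) hm.le_apply
  · exact hm (Nat.lt_succ_self _)
  · simpa [initSeg_succ] using (hrun (i + 1)).2.1

theorem HasStrategyI.branches_inter_nonempty {A : Set (ℕ → Sph E)} (h : HasStrategyI F δ A)
    {T : Set (List (Sph E))} (hT : IsBlockTree F δ T) : (branches T ∩ A).Nonempty := by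
  obtain ⟨σ, hσ⟩ := h
  obtain ⟨⟨t, ht⟩, hpre, hsucc⟩ := hT
  obtain ⟨z, hz⟩ := exists_seq_of_extend
    (fun l : List (Sph E × NonemptyInterval ℕ) => l.map Prod.fst ∈ T)
    (fun l a => ‖a.1.vec - F.proj a.2 a.1.vec‖ < δ l.length ∧ σ l < a.2.fst ∧
      ∀ b ∈ l, b.2.snd < a.2.fst) (hpre [] t List.nil_prefix ht) (by
      intro l hl
      obtain ⟨y, I, hy, hyI, hI⟩ := hsucc _ hl
      -- The sum bounds every earlier right endpoint.
      obtain ⟨i, hi, hi'⟩ := ((hI.eventually_gt_atTop (σ l)).and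
        (hI.eventually_gt_atTop ((l.map fun b => b.2.snd).sum))).exists
      refine ⟨(y i, I i), ⟨by simpa using hyI i, hi, fun b hb => ?_⟩, ?_⟩
      · refine lt_of_le_of_lt ?_ hi'
        exact List.single_le_sum (by simp) _ (List.mem_map.2 ⟨b, hb, rfl⟩)
      · have : y i ∈ {z : Sph E | l.map Prod.fst ++ [z] ∈ T} := hy ▸ ⟨i, rfl⟩
        simpa using this)
  refine ⟨fun i => (z i).1, fun n => ?_, hσ _ (fun i => (z i).2) fun i => ?_⟩
  · rw [← map_initSeg]
    exact (hz n).1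
  · obtain ⟨h1, h2, -⟩ := (hz i).2
    refine ⟨by simpa using h1, h2, (hz (i + 1)).2.2.2 _ ?_⟩
    exact mem_initSeg.2 ⟨i, Nat.lt_succ_self i, rfl⟩

/-- The auxiliary game does not require II's intervals to increase, which only helps II. Distance at
most `δ i / 2` is strictly below `δ i`, so a branch in `deltaInt δ B` cannot be that close to a
point outside `B`. -/
theorem hasStrategyI_half {B : Set (ℕ → Sph E)} (hB : MeasureTheory.AnalyticSet Bᶜ)
    (hδ : IsGauge δ)
    (h : ∀ T : Set (List (Sph E)), IsBlockTree F δ T → (branches T ∩ deltaInt δ B).Nonempty) :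
    HasStrategyI F (fun i => δ i / 2) (deltaInt (fun i => δ i / 2) B) := by
  rw [MeasureTheory.AnalyticSet] at hB
  rcases hB with hB | ⟨γ, hγ, hγB⟩
  · rw [Set.compl_empty_iff] at hB
    subst hB
    exact ⟨fun _ => 0, fun _ _ _ _ _ => Set.mem_univ _⟩
  have hD : ∀ k, Antitone (fun n => farSet F E (δ k / 2) n) := by
    rintro k m n hmn x ⟨I, hI, hx⟩
    exact ⟨I, hmn.trans_lt hI, hx⟩
  rcases strategy_or_tree (D := fun k n => farSet F E (δ k / 2) n)
    (G := Coherent γ fun i => δ i / 2) hD (fun _ _ x hc => hc.append x)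
    ⟨fun _ => 0, by simp, by simp⟩ with ⟨σ, hσ⟩ | ⟨T, hne, hpre, hsucc, hbr⟩
  · refine ⟨fun l => σ (l.map Prod.fst), fun x I hrun y hy => ?_⟩
    by_contra hyB
    obtain ⟨β, rfl⟩ : y ∈ Set.range γ := hγB ▸ hyB
    refine hσ x (fun i => ⟨I i, ?_, (hrun i).1⟩) β fun k l hlk => coherent_initSeg (fun j => ?_) hlk
    · simpa only [map_initSeg] using (hrun i).2.1
    · rw [dist_comm, dist_eq_norm_vec]
      exact (hy j).le
  · obtain ⟨x, hxT, hx⟩ := h T ⟨hne, hpre, fun s hs => by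
      obtain ⟨y, hy, hyD⟩ := hsucc s hs
      choose I hI hyI using hyD
      refine ⟨y, I, hy, fun i => (hyI i).trans (half_lt_self (hδ.2.1 _)), ?_⟩
      exact tendsto_atTop_mono (fun n => (hI n).le) tendsto_id⟩
    obtain ⟨β, hβ⟩ := hbr x hxT
    have hmem : γ β ∈ Bᶜ := hγB ▸ Set.mem_range_self β
    refine absurd (hx (γ β) fun i => ?_) hmem
    rw [← dist_eq_norm_vec, dist_comm]
    exact (dist_le_of_coherent hγ hβ i).trans_lt (half_lt_self (hδ.2.1 i))

/-! ### Compactness: from a strategy to a sequence `m` -/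

theorem FDD.coord_mem (F : FDD 𝕜 X) (x : X) (i : ℕ) : F.coord x i ∈ F.space i :=
  ((F.existsUnique_expansion x).choose i).2

/-- The points of `S_E` which are supported by `I` up to an error `r` have a finite net. -/
theorem exists_finite_net (F : FDD 𝕜 X) (E : Submodule 𝕜 X) (I : NonemptyInterval ℕ) {r : ℝ}
    (hr : 0 < r) : ∃ N : Set (Sph E), N.Finite ∧ (∀ y ∈ N, ‖y.vec - F.proj I y.vec‖ < r) ∧
      ∀ x : Sph E, ‖x.vec - F.proj I x.vec‖ < r → ∃ y ∈ N, ‖x.vec - y.vec‖ < 3 * r := by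
  let V : Submodule 𝕜 X := (Finset.Icc I.fst I.snd).sup F.space
  have : ∀ i, FiniteDimensional 𝕜 (F.space i) := F.finiteDimensional
  have hV : FiniteDimensional 𝕜 V := Submodule.finiteDimensional_finset_sup _ _
  have hproj : ∀ x, F.proj I x ∈ V := fun x => Submodule.sum_mem _ fun i hi =>
    Finset.le_sup (f := F.space) hi (F.coord_mem x i)
  have : ProperSpace V := FiniteDimensional.proper_rclike 𝕜 V
  let P : Sph E → V := fun x => ⟨F.proj I x.vec, hproj _⟩
  let S : Set (Sph E) := {x | ‖x.vec - F.proj I x.vec‖ < r}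
  -- Boundedness comes from closeness to unit vectors, so no continuity of the projection is needed.
  have hbdd : TotallyBounded (P '' S) := by
    refine (isCompact_closedBall (0 : V) (1 + r)).totallyBounded.subset ?_
    rintro _ ⟨x, hx, rfl⟩
    rw [mem_closedBall_zero_iff]
    have h1 : ‖x.vec‖ = 1 := mem_sphere_zero_iff_norm.1 x.2
    calc ‖F.proj I x.vec‖ = ‖x.vec - (x.vec - F.proj I x.vec)‖ := by rw [sub_sub_cancel]
      _ ≤ ‖x.vec‖ + ‖x.vec - F.proj I x.vec‖ := norm_sub_le _ _
      _ ≤ 1 + r := by rw [h1]; exact add_le_add_right (le_of_lt hx) _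
  obtain ⟨t, hts, htf, htc⟩ := Metric.finite_approx_of_totallyBounded hbdd r hr
  obtain ⟨N, hNS, hNf, rfl⟩ := Set.exists_subset_image_finite_and.1 ⟨t, hts, htf, rfl⟩
  refine ⟨N, hNf, hNS, fun x hx => ?_⟩
  obtain ⟨_, ⟨y, hy, rfl⟩, hxy⟩ := Set.mem_iUnion₂.1 (htc ⟨x, hx, rfl⟩)
  have hxy' : ‖F.proj I x.vec - F.proj I y.vec‖ < r := by
    rwa [Metric.mem_ball, dist_eq_norm] at hxy
  refine ⟨y, hy, ?_⟩
  have hy' : ‖F.proj I y.vec - y.vec‖ < r := by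
    rw [norm_sub_rev]
    exact hNS hy
  calc ‖x.vec - y.vec‖ = ‖(x.vec - F.proj I x.vec) + (F.proj I x.vec - F.proj I y.vec)
        + (F.proj I y.vec - y.vec)‖ := by congr 1; abel
    _ ≤ ‖x.vec - F.proj I x.vec‖ + ‖F.proj I x.vec - F.proj I y.vec‖
        + ‖F.proj I y.vec - y.vec‖ := norm_add₃_le
    _ < r + r + r := by gcongr
    _ = 3 * r := by ring

/-- The strategy is consulted only on net points `y i` replacing `x i`: the net costs `3 * (δ i /
4)`, which leaves `δ i / 4` for the perturbation `z`. -/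
theorem exists_separates_of_hasStrategyI {B : Set (ℕ → Sph E)} (hδ : IsGauge δ)
    (h : HasStrategyI F δ (deltaInt δ B)) :
    ∃ m : ℕ → ℕ, StrictMono m ∧ ∀ x : ℕ → Sph E, Separates F (fun i => δ i / 4) m x →
      x ∈ deltaInt (fun i => δ i / 4) B := by
  obtain ⟨σ, hσ⟩ := h
  choose N hNf hN hNx using fun (k : ℕ) (I : NonemptyInterval ℕ) =>
    exists_finite_net F E I (div_pos (hδ.2.1 k) (by norm_num : (0 : ℝ) < 4))
  let M : ℕ → Set (Sph E × NonemptyInterval ℕ) := fun a =>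
    {p | ∃ k ≤ a, p.2.snd ≤ a ∧ p.1 ∈ N k p.2}
  have hM : ∀ a, (M a).Finite := by
    intro a
    have hI : {I : NonemptyInterval ℕ | I.snd ≤ a}.Finite := by
      refine ((Set.finite_Iic a).prod (Set.finite_Iic a)).of_injOn (f := NonemptyInterval.toProd)
        (fun I hI => Set.mk_mem_prod (I.fst_le_snd.trans hI) hI) fun I _ J _ h => NonemptyInterval.toProd_injective h
    refine ((Set.finite_Iic a).biUnion fun k _ => hI.biUnion fun I _ =>
      (hNf k I).prod (Set.finite_singleton I)).subset ?_
    rintro ⟨y, I⟩ ⟨k, hk, hIa, hy⟩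
    simp only [Set.mem_iUnion]
    exact ⟨k, hk, I, hIa, hy, rfl⟩
  have hbound : ∀ a, ∃ b, a < b ∧
      ∀ l : List (Sph E × NonemptyInterval ℕ), l.length ≤ a → (∀ p ∈ l, p ∈ M a) → σ l < b := by
    intro a
    have hfin : {l : List (Sph E × NonemptyInterval ℕ) | l.length ≤ a ∧ ∀ p ∈ l, p ∈ M a}.Finite := by
      have := (hM a).to_subtype
      refine ((List.finite_length_le (M a) a).image (List.map Subtype.val)).subset ?_
      rintro l ⟨hl, hlM⟩
      exact ⟨l.attachWith (· ∈ M a) hlM, by simpa using hl, List.attachWith_map_subtype_val _⟩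
    obtain ⟨c, hc⟩ := (hfin.image σ).bddAbove
    exact ⟨max a c + 1, by omega, fun l hl hlM =>
      Nat.lt_succ_of_le ((hc ⟨l, ⟨hl, hlM⟩, rfl⟩).trans (le_max_right _ _))⟩
  choose g hg hgσ using hbound
  let m : ℕ → ℕ := fun j => Nat.rec (σ []) (fun _ a => g a) j
  have hm : StrictMono m := strictMono_nat_of_lt_succ fun j => hg _
  refine ⟨m, hm, ?_⟩
  rintro x ⟨I, ⟨hbef, hblock⟩, hm0, hsep⟩ z hz
  choose y hy hxy using fun i => hNx i (I i) (x i) (by rw [norm_sub_rev]; exact hblock i)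
  have hmono : StrictMono fun i => (I i).snd := strictMono_nat_of_lt_succ fun i =>
    (hbef i).trans_le (I (i + 1)).fst_le_snd
  refine hσ y I (fun i => ⟨(hN i (I i) _ (hy i)).trans ?_, ?_, hbef i⟩) z fun i => ?_
  · linarith [hδ.2.1 i]
  · cases i with
    | zero => simpa [m] using hm0
    | succ i =>
      -- All moves so far end before `m j`, hence lie in `M (m j)`, and `m (j + 1) = g (m j)`
      -- exceeds I's answer to them.
      obtain ⟨j, hj, -, hj'⟩ := hsep i
      refine lt_trans (hgσ (m j) _ ?_ ?_) hj'
      · rw [length_initSeg]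
        exact (Nat.succ_le_succ hmono.le_apply).trans hj
      · intro p hp
        obtain ⟨k, hk, rfl⟩ := mem_initSeg.1 hp
        have hki : (I k).snd ≤ (I i).snd := hmono.monotone (Nat.le_of_lt_succ hk)
        have hkk : k ≤ (I k).snd := hmono.le_apply
        exact ⟨k, by omega, by dsimp only; omega, hy k⟩
  · calc ‖(z i).vec - (y i).vec‖
        ≤ ‖(z i).vec - (x i).vec‖ + ‖(x i).vec - (y i).vec‖ := norm_sub_le_norm_sub_add_norm_sub _ _ _
      _ < δ i / 4 + 3 * (δ i / 4) := add_lt_add (hz i) (hxy i)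
      _ = δ i := by ring

end Game

end ApproxGame

theorem mainTheorem1 {𝕜 X : Type*} [RCLike 𝕜] [NormedAddCommGroup X] [NormedSpace 𝕜 X]
    [CompleteSpace X] (F : ApproxGame.FDD 𝕜 X) (E : Submodule 𝕜 X)
    (hE : IsClosed (E : Set X)) (B : Set (ℕ → ApproxGame.Sph E))
    (hB : MeasureTheory.AnalyticSet Bᶜ) :
    List.TFAE [
      ∃ δ : ℕ → ℝ, ApproxGame.IsGauge δ ∧ ∃ m : ℕ → ℕ, StrictMono m ∧
        ∀ x : ℕ → ApproxGame.Sph E,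
          ApproxGame.Separates F δ m x → x ∈ ApproxGame.deltaInt δ B,
      ∃ δ : ℕ → ℝ, ApproxGame.IsGauge δ ∧
        ApproxGame.HasStrategyI F δ (ApproxGame.deltaInt δ B),
      ∃ δ : ℕ → ℝ, ApproxGame.IsGauge δ ∧
        ∀ T : Set (List (ApproxGame.Sph E)), ApproxGame.IsBlockTree F δ T →
          (ApproxGame.branches T ∩ ApproxGame.deltaInt δ B).Nonempty] := by
  tfae_have 1 → 2 := fun ⟨δ, hδ, _, hm, h⟩ =>
    ⟨δ, hδ, ApproxGame.hasStrategyI_of_separates hm h⟩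
  tfae_have 2 → 1 := fun ⟨δ, hδ, h⟩ =>
    ⟨_, hδ.div four_pos, ApproxGame.exists_separates_of_hasStrategyI hδ h⟩
  tfae_have 2 → 3 := fun ⟨δ, hδ, h⟩ => ⟨δ, hδ, fun _ hT => h.branches_inter_nonempty hT⟩
  tfae_have 3 → 2 := fun ⟨δ, hδ, h⟩ =>
    ⟨_, hδ.div two_pos, ApproxGame.hasStrategyI_half hB hδ h⟩
  tfae_finish
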